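/- A Heyting semilattice is a set \(H\) with a constant \(1\) and binary operations \(\wedge,\Rightarrow\) satisfying \(1\wedge x=x\), \(x\wedge x=x\), \(x\wedge y=y\wedge x\), \(x\wedge(y\wedge z)=(x\wedge y)\wedge z\), \((x\Rightarrow x)=1\), \(x\wedge(x\Rightarrow y)=x\wedge y\), \(y\wedge(x\Rightarrow y)=y\) and \(x\Rightarrow(y\wedge z)=(x\Rightarrow y)\wedge(x\Rightarrow z)\). Let \(\mathsf{HSLat}\) be the category of Heyting semilattices and maps preserving \(1,\wedge,\Rightarrow\). In a pointed category with binary products, two morphisms \(f\colon X\to A\) and \(g\colon Y\to A\) Huq-commute if there is a morphism \(\varphi\colon X\times Y\to A\) with \(\varphi\circ(1_X,0)=f\) and \(\varphi\circ(0,1_Y)=g\). A functor \(F\) between such categories reflects Huq-commuting pairs if, whenever \(F(f)\) and \(F(g)\) Huq-commute, so do \(f\) and \(g\). For an object \(B\) of a category \(\mathcal C\), \(\mathsf{Pt}_B(\mathcal C)\) denotes the category of points over \(B\): its objects are triples \((A,\alpha\colon A\to B,\beta\colon B\to A)\) with \(\alpha\beta=1_B\), and its morphisms are the morphisms in \(\mathcal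 C\) that commute with the projections \(\alpha\) and with the sections \(\beta\). If \(\mathcal C\) is pointed with finite limits, then \(\mathsf{Pt}_B(\mathcal C)\) is pointed with binary products. The kernel functor \(\mathrm{Ker}_B\colon\mathsf{Pt}_B(\mathcal C)\to\mathcal C\) sends \((A,\alpha,\beta)\) to the kernel of \(\alpha\), and for \(p\colon E\to B\) the change-of-base functor \(p^*\colon\mathsf{Pt}_B(\mathcal C)\to\mathsf{Pt}_E(\mathcal C)\) is given by pullback along \(p\). (Up to the isomorphism \(\mathsf{Pt}_0(\mathcal C)\cong\mathcal C\), \(\mathrm{Ker}_B\) is the change-of-base functor along \(0\to B\).) Theorem. The category \(\mathsf{HSLat}\) satisfies the condition (SSH): all change-of-base functors of its fibration of points reflect Huq-commuting pairs of morphisms. Explicitly, for every Heyting semilattice \(B\), the kernel functor \(\mathrm{Ker}_B\colon\mathsf{Pt}_B(\mathsf{HSLat})\to\mathsf{HSLat}\) reflects Huq-commuting pairs of morphisms, and for every morphism \(p\colon E\to B\) of Heyting semilattices so does \(p^*\colon\mathsf{Pt}_B(\mathsf{HSLat})\to\mathsf{Pt}_E(\mathsf{HSLat})\). -/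

import Mathlib

open CategoryTheory CategoryTheory.Limits

universe u v w

/-! ## Heyting semilattices and their category -/

/-- A Heyting semilattice: a set with a constant `⊤` (written 1 in the equational presentation),
a meet `⊓` and an implication `⇨`, subject to the usual eight identities. -/
class HeytingSemilattice (H : Type u) extends Top H, Min H, HImp H where
  top_inf (x : H) : ⊤ ⊓ x = x
  inf_self (x : H) : x ⊓ x = x
  inf_comm (x y : H) : x ⊓ y = y ⊓ x
  inf_assoc (x y z : H) : x ⊓ (y ⊓ z) = (x ⊓ y) ⊓ z
  himp_self (x : H) : x ⇨ x = ⊤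
  inf_himp (x y : H) : x ⊓ (x ⇨ y) = x ⊓ y
  inf_himp_right (x y : H) : y ⊓ (x ⇨ y) = y
  himp_inf (x y z : H) : x ⇨ (y ⊓ z) = (x ⇨ y) ⊓ (x ⇨ z)

/-- Morphisms of Heyting semilattices preserve the constant and the two operations. -/
@[ext]
structure HeytingSemilatticeHom (H K : Type u) [HeytingSemilattice H] [HeytingSemilattice K] where
  toFun : H → K
  map_top : toFun ⊤ = ⊤
  map_inf (x y : H) : toFun (x ⊓ y) = toFun x ⊓ toFun y
  map_himp (x y : H) : toFun (x ⇨ y) = toFun x ⇨ toFun y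

/-- The objects of the category of Heyting semilattices. -/
structure HSLat : Type (u + 1) where
  carrier : Type u
  [str : HeytingSemilattice carrier]

attribute [instance] HSLat.str

namespace HSLat

instance : Category.{u} HSLat.{u} where
  Hom A B := HeytingSemilatticeHom A.carrier B.carrier
  id A := ⟨fun x => x, rfl, fun _ _ => rfl, fun _ _ => rfl⟩
  comp f g := ⟨fun x => g.toFun (f.toFun x), by rw [f.map_top, g.map_top],
    fun x y => by rw [f.map_inf, g.map_inf], fun x y => by rw [f.map_himp, g.map_himp]⟩

theorem hom_ext {A B : HSLat.{u}} {f g : A ⟶ B} (h : ∀ x, f.toFun x = g.toFun x) : f = g :=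
  HeytingSemilatticeHom.ext (funext h)

@[simp] theorem id_apply {A : HSLat.{u}} (x : A.carrier) :
    HeytingSemilatticeHom.toFun (𝟙 A) x = x := rfl

@[simp] theorem comp_apply {A B D : HSLat.{u}} (f : A ⟶ B) (g : B ⟶ D) (x : A.carrier) :
    HeytingSemilatticeHom.toFun (f ≫ g) x = g.toFun (f.toFun x) := rfl

/-- The zero morphism is constant with value `⊤`. -/
instance : HasZeroMorphisms HSLat.{u} where
  zero _ _ := ⟨⟨fun _ => ⊤, rfl, fun _ _ => (HeytingSemilattice.inf_self _).symm,
    fun _ _ => (HeytingSemilattice.himp_self _).symm⟩⟩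
  comp_zero _ _ := rfl
  zero_comp _ _ _ f := hom_ext fun _ => f.map_top

/-- The one-element Heyting semilattice. -/
instance : HeytingSemilattice PUnit.{u + 1} where
  top := PUnit.unit
  min _ _ := PUnit.unit
  himp _ _ := PUnit.unit
  top_inf _ := rfl
  inf_self _ := rfl
  inf_comm _ _ := rfl
  inf_assoc _ _ _ := rfl
  himp_self _ := rfl
  inf_himp _ _ := rfl
  inf_himp_right _ _ := rfl
  himp_inf _ _ _ := rfl

theorem isZero_punit : IsZero (HSLat.mk PUnit.{u + 1}) where
  unique_to _ := ⟨⟨⟨0⟩, fun f => hom_ext fun _ => f.map_top⟩⟩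
  unique_from _ := ⟨⟨⟨0⟩, fun _ => hom_ext fun _ => rfl⟩⟩

instance : HasZeroObject HSLat.{u} := ⟨⟨_, isZero_punit⟩⟩

/-- The set-theoretic pullback of Heyting semilattices, with componentwise operations. -/
instance pullbackStr {A B D : HSLat.{u}} (f : A ⟶ D) (g : B ⟶ D) :
    HeytingSemilattice {p : A.carrier × B.carrier // f.toFun p.1 = g.toFun p.2} where
  top := ⟨(⊤, ⊤), by rw [f.map_top, g.map_top]⟩
  min p q := ⟨(p.1.1 ⊓ q.1.1, p.1.2 ⊓ q.1.2), by rw [f.map_inf, g.map_inf, p.2, q.2]⟩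
  himp p q := ⟨(p.1.1 ⇨ q.1.1, p.1.2 ⇨ q.1.2), by rw [f.map_himp, g.map_himp, p.2, q.2]⟩
  top_inf _ := Subtype.ext (Prod.ext (HeytingSemilattice.top_inf _) (HeytingSemilattice.top_inf _))
  inf_self _ :=
    Subtype.ext (Prod.ext (HeytingSemilattice.inf_self _) (HeytingSemilattice.inf_self _))
  inf_comm _ _ :=
    Subtype.ext (Prod.ext (HeytingSemilattice.inf_comm _ _) (HeytingSemilattice.inf_comm _ _))
  inf_assoc _ _ _ :=
    Subtype.ext (Prod.ext (HeytingSemilattice.inf_assoc _ _ _) (HeytingSemilattice.inf_assoc _ _ _))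
  himp_self _ :=
    Subtype.ext (Prod.ext (HeytingSemilattice.himp_self _) (HeytingSemilattice.himp_self _))
  inf_himp _ _ :=
    Subtype.ext (Prod.ext (HeytingSemilattice.inf_himp _ _) (HeytingSemilattice.inf_himp _ _))
  inf_himp_right _ _ := Subtype.ext
    (Prod.ext (HeytingSemilattice.inf_himp_right _ _) (HeytingSemilattice.inf_himp_right _ _))
  himp_inf _ _ _ :=
    Subtype.ext (Prod.ext (HeytingSemilattice.himp_inf _ _ _) (HeytingSemilattice.himp_inf _ _ _))

instance : HasPullbacks HSLat.{u} := by
  refine @hasPullbacks_of_hasLimit_cospan HSLat.{u} _ ?_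
  intro A B D f g
  let P : HSLat.{u} := ⟨{p : A.carrier × B.carrier // f.toFun p.1 = g.toFun p.2}⟩
  let p₁ : P ⟶ A := ⟨fun p => p.1.1, rfl, fun _ _ => rfl, fun _ _ => rfl⟩
  let p₂ : P ⟶ B := ⟨fun p => p.1.2, rfl, fun _ _ => rfl, fun _ _ => rfl⟩
  have w : p₁ ≫ f = p₂ ≫ g := hom_ext fun p => p.2
  exact ⟨⟨⟨PullbackCone.mk p₁ p₂ w, PullbackCone.IsLimit.mk w
    (fun s => ⟨fun x => ⟨(s.fst.toFun x, s.snd.toFun x),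
        congrArg (fun h : s.pt ⟶ D => h.toFun x) s.condition⟩,
      Subtype.ext (Prod.ext s.fst.map_top s.snd.map_top),
      fun x y => Subtype.ext (Prod.ext (s.fst.map_inf x y) (s.snd.map_inf x y)),
      fun x y => Subtype.ext (Prod.ext (s.fst.map_himp x y) (s.snd.map_himp x y))⟩)
    (fun _ => rfl) (fun _ => rfl)
    (fun s m h₁ h₂ => hom_ext fun x => Subtype.ext (Prod.ext
      (congrArg (fun h : s.pt ⟶ A => h.toFun x) h₁)
      (congrArg (fun h : s.pt ⟶ B => h.toFun x) h₂)))⟩⟩⟩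

instance : HasFiniteLimits HSLat.{u} := hasFiniteLimits_of_hasTerminal_and_pullbacks

end HSLat

/-! ## Huq-commuting pairs -/

/-- Two morphisms with common codomain Huq-commute when they admit a cooperator, i.e. a morphism
`φ : X ⨯ Y ⟶ A` with `φ ∘ (1, 0) = f` and `φ ∘ (0, 1) = g`. -/
def HuqCommute {C : Type u} [Category.{v} C] [HasZeroMorphisms C] [HasBinaryProducts C]
    {X Y A : C} (f : X ⟶ A) (g : Y ⟶ A) : Prop :=
  ∃ φ : X ⨯ Y ⟶ A, prod.lift (𝟙 X) 0 ≫ φ = f ∧ prod.lift 0 (𝟙 Y) ≫ φ = g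

/-- A functor reflects Huq-commuting pairs of morphisms. -/
def ReflectsHuqCommutingPairs {C : Type u} [Category.{v} C] [HasZeroMorphisms C]
    [HasBinaryProducts C] {D : Type w} [Category.{v} D] [HasZeroMorphisms D]
    [HasBinaryProducts D] (F : C ⥤ D) : Prop :=
  ∀ ⦃X Y A : C⦄ (f : X ⟶ A) (g : Y ⟶ A), HuqCommute (F.map f) (F.map g) → HuqCommute f g

/-! ## The fibration of points -/

/-- A point over `B`: a morphism to `B` together with a chosen section. -/
structure Pt {C : Type u} [Category.{v} C] (B : C) where
  obj : C
  proj : obj ⟶ B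
  sec : B ⟶ obj
  sec_proj : sec ≫ proj = 𝟙 B

namespace Pt

variable {C : Type u} [Category.{v} C]

attribute [simp] sec_proj

@[simp] theorem sec_proj_assoc {B Z : C} (P : Pt B) (h : B ⟶ Z) : P.sec ≫ P.proj ≫ h = h := by
  rw [← Category.assoc, P.sec_proj, Category.id_comp]

/-- A morphism of points over `B` commutes with the projections and with the sections. -/
@[ext]
structure Hom {B : C} (P Q : Pt B) where
  hom : P.obj ⟶ Q.obj
  hom_proj : hom ≫ Q.proj = P.proj
  sec_hom : P.sec ≫ hom = Q.sec

attribute [simp] Hom.hom_proj Hom.sec_hom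

@[simp] theorem Hom.hom_proj_assoc {B Z : C} {P Q : Pt B} (f : Hom P Q) (h : B ⟶ Z) :
    f.hom ≫ Q.proj ≫ h = P.proj ≫ h := by
  rw [← Category.assoc, f.hom_proj]

@[simp] theorem Hom.sec_hom_assoc {B Z : C} {P Q : Pt B} (f : Hom P Q) (h : Q.obj ⟶ Z) :
    P.sec ≫ f.hom ≫ h = Q.sec ≫ h := by
  rw [← Category.assoc, f.sec_hom]

instance (B : C) : Category.{v} (Pt B) where
  Hom P Q := Hom P Q
  id P := ⟨𝟙 P.obj, by simp, by simp⟩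
  comp f g := ⟨f.hom ≫ g.hom, by simp, by simp⟩

@[ext]
theorem hom_ext {B : C} {P Q : Pt B} {f g : P ⟶ Q} (h : f.hom = g.hom) : f = g := Hom.ext h

@[simp] theorem id_hom {B : C} (P : Pt B) : Hom.hom (𝟙 P) = 𝟙 P.obj := rfl

@[simp] theorem comp_hom {B : C} {P Q R : Pt B} (f : P ⟶ Q) (g : Q ⟶ R) :
    Hom.hom (f ≫ g) = f.hom ≫ g.hom := rfl

/-- The category of points over `B` is pointed: its zero object is `(B, 1, 1)`, so the zero
morphism from `P` to `Q` is the projection of `P` followed by the section of `Q`. -/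
instance (B : C) : HasZeroMorphisms (Pt B) where
  zero P Q := ⟨⟨P.proj ≫ Q.sec, by simp, by simp⟩⟩
  comp_zero f R := hom_ext (f.hom_proj_assoc R.sec)
  zero_comp P {Q R} g := hom_ext (by
    change (P.proj ≫ Q.sec) ≫ g.hom = P.proj ≫ R.sec
    simp)

/-- The product of two points over `B` is their pullback over `B`. -/
instance (B : C) [HasPullbacks C] : HasBinaryProducts (Pt B) := by
  have : ∀ P Q : Pt B, HasLimit (pair P Q) := fun P Q => by
    let R : Pt B :=
      { obj := pullback P.proj Q.proj
        proj := pullback.fst P.proj Q.proj ≫ P.proj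
        sec := pullback.lift P.sec Q.sec (by simp)
        sec_proj := by rw [pullback.lift_fst_assoc, P.sec_proj] }
    let r₁ : R ⟶ P := ⟨pullback.fst P.proj Q.proj, rfl, pullback.lift_fst _ _ _⟩
    let r₂ : R ⟶ Q := ⟨pullback.snd P.proj Q.proj, pullback.condition.symm,
      pullback.lift_snd _ _ _⟩
    let l : ∀ {S : Pt B}, (S ⟶ P) → (S ⟶ Q) → (S ⟶ R) := fun {S} a b =>
      { hom := pullback.lift a.hom b.hom (a.hom_proj.trans b.hom_proj.symm)
        hom_proj := (pullback.lift_fst_assoc _ _ _ _).trans a.hom_proj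
        sec_hom := by
          apply pullback.hom_ext
          · rw [Category.assoc, pullback.lift_fst, pullback.lift_fst, a.sec_hom]
          · rw [Category.assoc, pullback.lift_snd, pullback.lift_snd, b.sec_hom] }
    exact ⟨⟨⟨BinaryFan.mk r₁ r₂, BinaryFan.isLimitMk
      (fun s => l s.fst s.snd)
      (fun s => hom_ext (pullback.lift_fst _ _ _))
      (fun s => hom_ext (pullback.lift_snd _ _ _))
      (fun s m h₁ h₂ => hom_ext (by
        apply pullback.hom_ext
        · exact (congrArg Hom.hom h₁).trans (pullback.lift_fst _ _ _).symm
        · exact (congrArg Hom.hom h₂).trans (pullback.lift_snd _ _ _).symm))⟩⟩⟩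
  exact hasBinaryProducts_of_hasLimit_pair _

/-- The kernel functor, sending a point over `B` to the kernel of its projection. -/
noncomputable def ker [HasZeroMorphisms C] [HasKernels C] (B : C) : Pt B ⥤ C where
  obj P := kernel P.proj
  map {P Q} f := kernel.lift Q.proj (kernel.ι P.proj ≫ f.hom) (by simp)

/-- The change-of-base functor along `p : E ⟶ B`, given by pulling back points along `p`. -/
noncomputable def changeOfBase [HasPullbacks C] {E B : C} (p : E ⟶ B) : Pt B ⥤ Pt E where
  obj P :=
    { obj := pullback P.proj p
      proj := pullback.snd P.proj p
      sec := pullback.lift (p ≫ P.sec) (𝟙 E) (by simp)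
      sec_proj := pullback.lift_snd _ _ _ }
  map {P Q} f :=
    { hom := pullback.lift (pullback.fst P.proj p ≫ f.hom) (pullback.snd P.proj p)
        (by simp [pullback.condition])
      hom_proj := pullback.lift_snd _ _ _
      sec_hom := by
        apply pullback.hom_ext
        · simp [pullback.lift_fst, pullback.lift_fst_assoc]
        · simp [pullback.lift_snd] }
  map_id P := hom_ext (by
    apply pullback.hom_ext
    · simp
    · simp)
  map_comp f g := hom_ext (by
    apply pullback.hom_ext
    · simp [pullback.lift_fst, pullback.lift_fst_assoc]
    · simp [pullback.lift_snd])

end Pt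

/-! ## The strong Smith-is-Huq condition -/

/-- The condition (SSH): all change-of-base functors of the fibration of points reflect
Huq-commuting pairs of morphisms; this is required of the kernel functors `Pt B ⥤ C` (change of
base along `0 ⟶ B`, followed by the isomorphism from `Pt 0` to `C`) as well as of the functors
`Pt B ⥤ Pt E` given by pulling back along an arbitrary morphism `E ⟶ B`. -/
def SatisfiesSSH (C : Type u) [Category.{v} C] [HasZeroObject C] [HasZeroMorphisms C]
    [HasFiniteLimits C] : Prop :=
  (∀ B : C, ReflectsHuqCommutingPairs (Pt.ker B)) ∧
    ∀ ⦃E B : C⦄ (p : E ⟶ B), ReflectsHuqCommutingPairs (Pt.changeOfBase p)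

/-! ## The order of a Heyting semilattice -/

namespace HeytingSemilattice

variable {H : Type u} [HeytingSemilattice H]

/-! Over every base, Huq-commutation amounts to one elementwise condition, `KernelsOrthogonal`: for
`k`, `l` in the kernels of the two domains, `f k ⇨ g l = g l` and `g l ⇨ f k = f k`. A cooperator
forces it, since `(k, ⊤)` and `(⊤, l)` are orthogonal in the product. Both kinds of functor in (SSH)
retain the kernels, so the condition descends to `f` and `g`.

Conversely, write `b` also for its section in `A`. The cooperator sends `(x, y)` over `b` to the
explicit term `glue (f x) (g y) b`. That this is a homomorphism is not computed from the formula.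
There are kernel elements `k`, `l` such that, modulo `f k`, `f x` equals `b` and the value equals `g
y`, and, modulo `g l`, `g y` equals `b` and the value equals `f x`. Joins need not exist, so `f k ∨
g l = ⊤` is replaced by the condition `Local` on values, under which agreement modulo `f k` and
modulo `g l` implies equality (`IsValue.unique`). `IsValue` is stable under `⊓` and `⇨`, so
uniqueness makes the cooperator a homomorphism. Orthogonality enters only to show that the glued
term is local (`local_glue`). -/

instance : SemilatticeInf H where
  le x y := x ⊓ y = x
  le_refl := inf_self
  le_trans x y z (hxy : x ⊓ y = x) (hyz : y ⊓ z = y) := show x ⊓ z = x by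
    rw [← hxy, ← inf_assoc, hyz]
  le_antisymm x y (hxy : x ⊓ y = x) (hyx : y ⊓ x = y) := by rw [← hxy, inf_comm, hyx]
  inf x y := x ⊓ y
  inf_le_left x y := show (x ⊓ y) ⊓ x = x ⊓ y by rw [inf_comm, inf_assoc, inf_self]
  inf_le_right x y := show (x ⊓ y) ⊓ y = x ⊓ y by rw [← inf_assoc, inf_self]
  le_inf x y z (hxy : x ⊓ y = x) (hxz : x ⊓ z = x) := show x ⊓ (y ⊓ z) = x by
    rw [inf_assoc, hxy, hxz]

instance : OrderTop H where
  le_top x := show x ⊓ ⊤ = x by rw [inf_comm, top_inf]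

theorem le_himp_iff (x y z : H) : x ≤ y ⇨ z ↔ x ⊓ y ≤ z := by
  constructor
  · intro h
    calc x ⊓ y ≤ (y ⇨ z) ⊓ y := inf_le_inf_right y h
      _ = y ⊓ z := by rw [inf_comm, inf_himp]
      _ ≤ z := inf_le_right
  · intro h
    have h₁ : x ≤ y ⇨ x := inf_himp_right y x
    have h₂ : y ⇨ x = y ⇨ (x ⊓ y) := by rw [himp_inf, himp_self, inf_comm, top_inf]
    have h₃ : y ⇨ (x ⊓ y) ≤ y ⇨ z := by
      change (y ⇨ (x ⊓ y)) ⊓ (y ⇨ z) = y ⇨ (x ⊓ y)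
      rw [← himp_inf]
      exact congrArg (y ⇨ ·) h
    exact h₁.trans (h₂.le.trans h₃)

theorem himp_inf_le (x y : H) : (x ⇨ y) ⊓ x ≤ y := (le_himp_iff _ _ _).1 le_rfl

theorem le_himp (x y : H) : y ≤ x ⇨ y := inf_himp_right x y

theorem le_himp_himp (x y : H) : x ≤ (x ⇨ y) ⇨ y := by
  rw [le_himp_iff, inf_comm]
  exact himp_inf_le x y

theorem himp_mono_right (x : H) {y z : H} (h : y ≤ z) : x ⇨ y ≤ x ⇨ z :=
  (le_himp_iff _ _ _).2 ((himp_inf_le x y).trans h)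

theorem himp_himp_inf_le (s c a : H) :
    (s ⇨ (c ⇨ a)) ⊓ c ≤ s ⇨ a := by
  rw [le_himp_iff]
  have h₁ : (s ⇨ (c ⇨ a)) ⊓ c ⊓ s ≤ c ⇨ a :=
    (inf_le_inf_right s inf_le_left).trans (himp_inf_le _ _)
  exact (le_inf h₁ (inf_le_left.trans inf_le_right)).trans (himp_inf_le c a)

theorem top_himp (x : H) : (⊤ : H) ⇨ x = x := by
  rw [← top_inf (⊤ ⇨ x), inf_himp, top_inf]

theorem himp_top (x : H) : x ⇨ (⊤ : H) = ⊤ := top_le_iff.1 (le_himp x ⊤)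

/-! ### Congruence modulo a principal filter -/

/-- Congruence modulo the principal filter of `s`. -/
def ModEq (s x y : H) : Prop := s ⊓ x = s ⊓ y

namespace ModEq

variable {s t x y z x' y' : H}

theorem refl (s x : H) : ModEq s x x := rfl

theorem symm (h : ModEq s x y) : ModEq s y x := Eq.symm h

theorem trans (h : ModEq s x y) (h' : ModEq s y z) : ModEq s x z := Eq.trans h h'

theorem mono (hst : t ≤ s) (h : ModEq s x y) : ModEq t x y := by
  have ht : t ⊓ s = t := hst
  unfold ModEq at *
  rw [← ht, ← inf_assoc, h, inf_assoc]

theorem inf (h : ModEq s x y) (h' : ModEq s x' y') : ModEq s (x ⊓ x') (y ⊓ y') := by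
  have key : ∀ u v : H, s ⊓ (u ⊓ v) = (s ⊓ u) ⊓ (s ⊓ v) := fun u v => inf_inf_distrib_left s u v
  unfold ModEq at *
  rw [key, key, h, h']

theorem himp_le (h : ModEq s x y) (h' : ModEq s x' y') : s ⊓ (x ⇨ x') ≤ y ⇨ y' := by
  rw [le_himp_iff]
  have hs : s ⊓ (x ⇨ x') ⊓ y ≤ s := inf_le_left.trans inf_le_left
  have hx : s ⊓ (x ⇨ x') ⊓ y ≤ x := (le_inf hs inf_le_right).trans (h.symm.le.trans inf_le_right)
  have hx' : s ⊓ (x ⇨ x') ⊓ y ≤ x' :=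
    (le_inf (inf_le_left.trans inf_le_right) hx).trans (himp_inf_le x x')
  exact (le_inf hs hx').trans (h'.le.trans inf_le_right)

theorem himp (h : ModEq s x y) (h' : ModEq s x' y') : ModEq s (x ⇨ x') (y ⇨ y') :=
  le_antisymm (le_inf inf_le_left (himp_le h h')) (le_inf inf_le_left (himp_le h.symm h'.symm))

end ModEq

/-- Provides the kernel elements required by `IsValue`: over a point, the biimplication of `x` with
the section of its projection lies in the kernel. -/
theorem modEq_biimplication (x b : H) : ModEq ((x ⇨ b) ⊓ (b ⇨ x)) x b := by
  apply le_antisymm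
  · exact le_inf inf_le_left
      ((inf_le_inf_right x inf_le_left).trans (himp_inf_le x b))
  · exact le_inf inf_le_left
      ((inf_le_inf_right b inf_le_right).trans (himp_inf_le b x))

/-! ### The gluing term -/

/-- The element which is `v` where `u` is `b`, and `u` where `v` is `b`. -/
def glue (u v b : H) : H :=
  (((u ⇨ b) ⊓ (v ⇨ b)) ⇨ b) ⊓ ((((u ⇨ b) ⇨ b) ⇨ u) ⊓ (((v ⇨ b) ⇨ b) ⇨ v))

theorem glue_comm (u v b : H) : glue u v b = glue v u b := by
  unfold glue
  rw [inf_comm (u ⇨ b), inf_comm (((u ⇨ b) ⇨ b) ⇨ u)]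

theorem himp_himp_inf (v b : H) : ((v ⇨ b) ⇨ b) ⊓ (((v ⇨ b) ⇨ b) ⇨ v) = v := by
  rw [inf_himp, inf_comm]
  exact le_himp_himp v b

/-- With `u = b` the middle factor is `⊤` and the first is `(v ⇨ b) ⇨ b`, so modus ponens with the
last factor leaves `v`. -/
theorem glue_base_left (v b : H) : glue b v b = v := by
  unfold glue
  rw [himp_self, top_inf, top_himp, himp_self, top_inf, himp_himp_inf]

theorem glue_base_right (u b : H) : glue u b b = u := by rw [glue_comm, glue_base_left]

theorem ModEq.glue {s u u' v v' : H} (hu : ModEq s u u') (hv : ModEq s v v') (b : H) :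
    ModEq s (glue u v b) (glue u' v' b) :=
  (((hu.himp (.refl s b)).inf (hv.himp (.refl s b))).himp (.refl s b)).inf
    ((((hu.himp (.refl s b)).himp (.refl s b)).himp hu).inf
      (((hv.himp (.refl s b)).himp (.refl s b)).himp hv))

end HeytingSemilattice

open HeytingSemilattice

namespace HeytingSemilatticeHom

variable {H K : Type u} [HeytingSemilattice H] [HeytingSemilattice K]

theorem map_glue (f : HeytingSemilatticeHom H K) (u v b : H) :
    f.toFun (glue u v b) = glue (f.toFun u) (f.toFun v) (f.toFun b) := by
  unfold glue
  simp only [f.map_inf, f.map_himp]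

end HeytingSemilatticeHom

/-! ## Huq-commuting pairs on elements -/

/-- A cooperator can be restricted to any object which receives `X` and `Y` like a product. -/
theorem HuqCommute.exists_hom {C : Type u} [Category.{v} C] [HasZeroMorphisms C]
    [HasBinaryProducts C] {X Y A R : C} {f : X ⟶ A} {g : Y ⟶ A} (h : HuqCommute f g)
    (r₁ : R ⟶ X) (r₂ : R ⟶ Y) (i₁ : X ⟶ R) (i₂ : Y ⟶ R) (h₁₁ : i₁ ≫ r₁ = 𝟙 X)
    (h₁₂ : i₁ ≫ r₂ = 0) (h₂₁ : i₂ ≫ r₁ = 0) (h₂₂ : i₂ ≫ r₂ = 𝟙 Y) :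
    ∃ ψ : R ⟶ A, i₁ ≫ ψ = f ∧ i₂ ≫ ψ = g := by
  obtain ⟨φ, hf, hg⟩ := h
  refine ⟨prod.lift r₁ r₂ ≫ φ, ?_, ?_⟩
  · rw [← Category.assoc, prod.comp_lift, h₁₁, h₁₂, hf]
  · rw [← Category.assoc, prod.comp_lift, h₂₁, h₂₂, hg]

namespace HSLat

/-- Elements `x` and `y` neither of which changes under implication from the other. -/
def Orthogonal {H : Type u} [HeytingSemilattice H] (x y : H) : Prop :=
  x ⇨ y = y ∧ y ⇨ x = x

theorem Orthogonal.map {A B : HSLat.{u}} (f : A ⟶ B) {x y : A.carrier} (h : Orthogonal x y) :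
    Orthogonal (f.toFun x) (f.toFun y) :=
  ⟨by rw [← f.map_himp, h.1], by rw [← f.map_himp, h.2]⟩

/-- The set-theoretic pullback of Heyting semilattices. -/
abbrev concretePullback {A B D : HSLat.{u}} (f : A ⟶ D) (g : B ⟶ D) : HSLat.{u} :=
  ⟨{p : A.carrier × B.carrier // f.toFun p.1 = g.toFun p.2}⟩

section

variable {A B D : HSLat.{u}} (f : A ⟶ D) (g : B ⟶ D)

/-- The first projection of the set-theoretic pullback. -/
def concreteFst : concretePullback f g ⟶ A := ⟨fun p => p.1.1, rfl, fun _ _ => rfl, fun _ _ => rfl⟩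

/-- The second projection of the set-theoretic pullback. -/
def concreteSnd : concretePullback f g ⟶ B := ⟨fun p => p.1.2, rfl, fun _ _ => rfl, fun _ _ => rfl⟩

variable {f g}

/-- The morphism into the set-theoretic pullback induced by a commutative square. -/
def concreteLift {S : HSLat.{u}} (a : S ⟶ A) (b : S ⟶ B)
    (w : ∀ x, f.toFun (a.toFun x) = g.toFun (b.toFun x)) : S ⟶ concretePullback f g :=
  ⟨fun x => ⟨(a.toFun x, b.toFun x), w x⟩, Subtype.ext (Prod.ext a.map_top b.map_top),
    fun x y => Subtype.ext (Prod.ext (a.map_inf x y) (b.map_inf x y)),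
    fun x y => Subtype.ext (Prod.ext (a.map_himp x y) (b.map_himp x y))⟩

theorem orthogonal_concretePullback {k : A.carrier} {l : B.carrier}
    (hk : f.toFun k = g.toFun ⊤) (hl : f.toFun ⊤ = g.toFun l) :
    Orthogonal (H := (concretePullback f g).carrier) ⟨(k, ⊤), hk⟩ ⟨(⊤, l), hl⟩ :=
  ⟨Subtype.ext (Prod.ext (himp_top k) (HeytingSemilattice.top_himp l)),
    Subtype.ext (Prod.ext (HeytingSemilattice.top_himp k) (himp_top l))⟩

/-- A compatible pair of elements comes from an element of the pullback. -/
theorem exists_pullback_element (x : A.carrier) (y : B.carrier) (w : f.toFun x = g.toFun y) :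
    ∃ z : (pullback f g).carrier,
      (pullback.fst f g).toFun z = x ∧ (pullback.snd f g).toFun z = y := by
  let c : concretePullback f g ⟶ pullback f g :=
    pullback.lift (concreteFst f g) (concreteSnd f g) (hom_ext fun p => p.2)
  have h₁ : c ≫ pullback.fst f g = concreteFst f g := pullback.lift_fst _ _ _
  have h₂ : c ≫ pullback.snd f g = concreteSnd f g := pullback.lift_snd _ _ _
  exact ⟨c.toFun ⟨(x, y), w⟩, congrArg (fun m => m.toFun ⟨(x, y), w⟩) h₁,
    congrArg (fun m => m.toFun ⟨(x, y), w⟩) h₂⟩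

/-- An element sent to `⊤` comes from an element of the kernel. -/
theorem exists_kernel_element (x : A.carrier) (w : f.toFun x = ⊤) :
    ∃ z : (kernel f).carrier, (kernel.ι f).toFun z = x := by
  let c : concretePullback f (0 : A ⟶ D) ⟶ kernel f :=
    kernel.lift f (concreteFst f 0) (hom_ext fun p => p.2)
  have h : c ≫ kernel.ι f = concreteFst f 0 := kernel.lift_ι _ _ _
  exact ⟨c.toFun ⟨(x, ⊤), w⟩, congrArg (fun m => m.toFun ⟨(x, ⊤), w⟩) h⟩

end

theorem orthogonal_of_huqCommute {X Y A : HSLat.{u}} {f : X ⟶ A} {g : Y ⟶ A}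
    (h : HuqCommute f g) (k : X.carrier) (l : Y.carrier) :
    Orthogonal (f.toFun k) (g.toFun l) := by
  -- A pullback of zero morphisms is a product, so `concretePullback` also serves here.
  obtain ⟨ψ, hf, hg⟩ := h.exists_hom (concreteFst (0 : X ⟶ X) (0 : Y ⟶ X)) (concreteSnd 0 0)
    (concreteLift (𝟙 X) 0 fun _ => rfl) (concreteLift 0 (𝟙 Y) fun _ => rfl) rfl rfl rfl rfl
  subst hf hg
  exact (orthogonal_concretePullback (f := (0 : X ⟶ X)) (g := (0 : Y ⟶ X)) rfl rfl).map ψ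

end HSLat

/-! ### Orthogonality of kernels in categories of points -/

namespace Pt

open HSLat

section

variable {B : HSLat.{u}} {P Q : Pt B}

theorem proj_sec_apply (P : Pt B) (b : B.carrier) : P.proj.toFun (P.sec.toFun b) = b :=
  congrArg (fun m => HeytingSemilatticeHom.toFun m b) P.sec_proj

theorem proj_hom_apply (f : P ⟶ Q) (x : P.obj.carrier) :
    Q.proj.toFun (f.hom.toFun x) = P.proj.toFun x :=
  congrArg (fun m => HeytingSemilatticeHom.toFun m x) f.hom_proj

theorem hom_sec_apply (f : P ⟶ Q) (b : B.carrier) :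
    f.hom.toFun (P.sec.toFun b) = Q.sec.toFun b :=
  congrArg (fun m => HeytingSemilatticeHom.toFun m b) f.sec_hom

theorem apply_eq_of_hom_eq {f g : P ⟶ Q} (h : f = g) (x : P.obj.carrier) :
    f.hom.toFun x = g.hom.toFun x := by rw [h]

end

variable {B : HSLat.{u}} {X Y A : Pt B}

/-- The images of the kernels of two points are elementwise orthogonal. -/
def KernelsOrthogonal (f : X ⟶ A) (g : Y ⟶ A) : Prop :=
  ∀ k l, X.proj.toFun k = ⊤ → Y.proj.toFun l = ⊤ → Orthogonal (f.hom.toFun k) (g.hom.toFun l)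

theorem kernelsOrthogonal_of_huqCommute {f : X ⟶ A} {g : Y ⟶ A} (h : HuqCommute f g) :
    KernelsOrthogonal f g := by
  let R : Pt B :=
    { obj := concretePullback X.proj Y.proj
      proj := concreteFst X.proj Y.proj ≫ X.proj
      sec := concreteLift X.sec Y.sec
        fun b => (X.proj_sec_apply b).trans (Y.proj_sec_apply b).symm
      sec_proj := X.sec_proj }
  let r₁ : R ⟶ X := ⟨concreteFst X.proj Y.proj, rfl, rfl⟩
  let r₂ : R ⟶ Y := ⟨concreteSnd X.proj Y.proj, HSLat.hom_ext fun p => p.2.symm, rfl⟩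
  let i₁ : X ⟶ R :=
    ⟨concreteLift (𝟙 X.obj) (X.proj ≫ Y.sec) fun x => (Y.proj_sec_apply _).symm, rfl,
      HSLat.hom_ext fun b => Subtype.ext (Prod.ext rfl
        (congrArg Y.sec.toFun (X.proj_sec_apply b)))⟩
  let i₂ : Y ⟶ R :=
    ⟨concreteLift (Y.proj ≫ X.sec) (𝟙 Y.obj) fun y => X.proj_sec_apply _,
      HSLat.hom_ext fun y => X.proj_sec_apply _,
      HSLat.hom_ext fun b => Subtype.ext (Prod.ext
        (congrArg X.sec.toFun (Y.proj_sec_apply b)) rfl)⟩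
  obtain ⟨ψ, hf, hg⟩ := h.exists_hom r₁ r₂ i₁ i₂ rfl rfl rfl rfl
  intro k l hk hl
  -- In points the zero morphism is projection followed by section, so the second component is `⊤`
  -- only because `k` lies in the kernel.
  have hk' : i₁.hom.toFun k = ⟨(k, ⊤), hk.trans Y.proj.map_top.symm⟩ :=
    Subtype.ext (Prod.ext rfl ((congrArg Y.sec.toFun hk).trans Y.sec.map_top))
  have hl' : i₂.hom.toFun l = ⟨(⊤, l), X.proj.map_top.trans hl.symm⟩ :=
    Subtype.ext (Prod.ext ((congrArg X.sec.toFun hl).trans X.sec.map_top) rfl)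
  rw [← apply_eq_of_hom_eq hf, ← apply_eq_of_hom_eq hg]
  change Orthogonal (ψ.hom.toFun (i₁.hom.toFun k)) (ψ.hom.toFun (i₂.hom.toFun l))
  rw [hk', hl']
  exact (orthogonal_concretePullback _ _).map ψ.hom

theorem kernelsOrthogonal_of_ker {f : X ⟶ A} {g : Y ⟶ A}
    (h : HuqCommute ((ker B).map f) ((ker B).map g)) : KernelsOrthogonal f g := by
  intro k l hk hl
  obtain ⟨k', rfl⟩ := exists_kernel_element k hk
  obtain ⟨l', rfl⟩ := exists_kernel_element l hl
  have hf : (ker B).map f ≫ kernel.ι A.proj = kernel.ι X.proj ≫ f.hom := kernel.lift_ι _ _ _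
  have hg : (ker B).map g ≫ kernel.ι A.proj = kernel.ι Y.proj ≫ g.hom := kernel.lift_ι _ _ _
  have := (orthogonal_of_huqCommute h k' l').map (kernel.ι A.proj)
  have hf' : (kernel.ι A.proj).toFun (((ker B).map f).toFun k') =
      f.hom.toFun ((kernel.ι X.proj).toFun k') :=
    congrArg (fun m => HeytingSemilatticeHom.toFun m k') hf
  have hg' : (kernel.ι A.proj).toFun (((ker B).map g).toFun l') =
      g.hom.toFun ((kernel.ι Y.proj).toFun l') :=
    congrArg (fun m => HeytingSemilatticeHom.toFun m l') hg
  rwa [hf', hg'] at this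

theorem kernelsOrthogonal_of_changeOfBase {E : HSLat.{u}} (p : E ⟶ B) {f : X ⟶ A} {g : Y ⟶ A}
    (h : HuqCommute ((changeOfBase p).map f) ((changeOfBase p).map g)) :
    KernelsOrthogonal f g := by
  intro k l hk hl
  -- Pairing with `⊤` places `k` in the kernel of the pulled-back point, whatever `p` is.
  obtain ⟨k', rfl, hk'⟩ := exists_pullback_element k ⊤ (hk.trans p.map_top.symm)
  obtain ⟨l', rfl, hl'⟩ := exists_pullback_element l ⊤ (hl.trans p.map_top.symm)
  have hf : ((changeOfBase p).map f).hom ≫ pullback.fst A.proj p =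
      pullback.fst X.proj p ≫ f.hom := pullback.lift_fst _ _ _
  have hg : ((changeOfBase p).map g).hom ≫ pullback.fst A.proj p =
      pullback.fst Y.proj p ≫ g.hom := pullback.lift_fst _ _ _
  have := (kernelsOrthogonal_of_huqCommute h k' l' hk' hl').map (pullback.fst A.proj p)
  have hf' : (pullback.fst A.proj p).toFun (((changeOfBase p).map f).hom.toFun k') =
      f.hom.toFun ((pullback.fst X.proj p).toFun k') :=
    congrArg (fun m => HeytingSemilatticeHom.toFun m k') hf
  have hg' : (pullback.fst A.proj p).toFun (((changeOfBase p).map g).hom.toFun l') =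
      g.hom.toFun ((pullback.fst Y.proj p).toFun l') :=
    congrArg (fun m => HeytingSemilatticeHom.toFun m l') hg
  rwa [hf', hg'] at this

/-! ## The cooperator -/

/-- The elements for which the images of the two kernels behave as if their joins were `⊤`. -/
def Local (f : X ⟶ A) (g : Y ⟶ A) (a : A.obj.carrier) : Prop :=
  ∀ k l, X.proj.toFun k = ⊤ → Y.proj.toFun l = ⊤ →
    (f.hom.toFun k ⇨ a) ⊓ (g.hom.toFun l ⇨ a) ≤ a

/-! ### Closure properties of local elements -/

section Local

variable {f : X ⟶ A} {g : Y ⟶ A} {a a' : A.obj.carrier}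

theorem KernelsOrthogonal.symm (h : KernelsOrthogonal f g) : KernelsOrthogonal g f :=
  fun k l hk hl => (h l k hl hk).symm

theorem Local.symm (h : Local f g a) : Local g f a := fun k l hk hl => by
  rw [HeytingSemilattice.inf_comm]
  exact h l k hl hk

theorem Local.inf (h : Local f g a) (h' : Local f g a') : Local f g (a ⊓ a') := by
  intro k l hk hl
  rw [himp_inf, himp_inf]
  exact le_inf ((inf_le_inf inf_le_left inf_le_left).trans (h k l hk hl))
    ((inf_le_inf inf_le_right inf_le_right).trans (h' k l hk hl))

/-- Only the consequent has to be local: currying moves `c` to the left, where it is discharged in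
both factors. -/
theorem Local.himp (c : A.obj.carrier) (h : Local f g a) : Local f g (c ⇨ a) := by
  intro k l hk hl
  rw [HeytingSemilattice.le_himp_iff]
  refine le_trans (le_inf ?_ ?_) (h k l hk hl)
  · exact (inf_le_inf_right c inf_le_left).trans (himp_himp_inf_le _ _ _)
  · exact (inf_le_inf_right c inf_le_right).trans (himp_himp_inf_le _ _ _)

theorem Local.glue {u v b : A.obj.carrier} (hb : Local f g b)
    (hu : Local f g (((u ⇨ b) ⇨ b) ⇨ u)) (hv : Local f g (((v ⇨ b) ⇨ b) ⇨ v)) :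
    Local f g (glue u v b) :=
  (hb.himp _).inf (hu.inf hv)

theorem Local.le_of_modEq (h : Local f g a') {k : X.obj.carrier} {l : Y.obj.carrier}
    (hk : X.proj.toFun k = ⊤) (hl : Y.proj.toFun l = ⊤)
    (hs : ModEq (f.hom.toFun k) a a') (ht : ModEq (g.hom.toFun l) a a') : a ≤ a' := by
  refine (le_inf ?_ ?_).trans (h k l hk hl)
  · rw [HeytingSemilattice.le_himp_iff, HeytingSemilattice.inf_comm, hs]
    exact inf_le_right
  · rw [HeytingSemilattice.le_himp_iff, HeytingSemilattice.inf_comm, ht]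
    exact inf_le_right

theorem local_of_proj_eq_top (h : KernelsOrthogonal f g) {k : X.obj.carrier}
    (hk : X.proj.toFun k = ⊤) : Local f g (f.hom.toFun k) :=
  fun _ l _ hl => inf_le_right.trans (h k l hk hl).2.le

/-- The section need not lie in the image of a kernel, so orthogonality is applied to a double
implication into it instead. -/
theorem local_sec (h : KernelsOrthogonal f g) (b : B.carrier) : Local f g (A.sec.toFun b) := by
  intro k l hk hl
  -- Since `l` projects to `⊤`, this projects to `(⊤ ⇨ b) ⇨ b = ⊤`. Orthogonality with `k` then
  -- bounds `f k ⇨ b` by `(g l ⇨ b) ⇨ b`.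
  have hl' : Y.proj.toFun ((l ⇨ Y.sec.toFun b) ⇨ Y.sec.toFun b) = ⊤ := by
    rw [Y.proj.map_himp, Y.proj.map_himp, hl, proj_sec_apply, HeytingSemilattice.top_himp, HeytingSemilattice.himp_self]
  have key := (h k _ hk hl').1
  rw [g.hom.map_himp, g.hom.map_himp, hom_sec_apply] at key
  refine (inf_le_inf_right _ ?_).trans (himp_inf_le (g.hom.toFun l ⇨ A.sec.toFun b) _)
  exact (himp_mono_right _ (le_himp _ _)).trans key.le

/-- This is why `glue` uses the factors `((u ⇨ b) ⇨ b) ⇨ u`: they come from kernels, hence are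
local. -/
theorem proj_himp_himp_himp (x : X.obj.carrier) {b : B.carrier} (hx : X.proj.toFun x = b) :
    X.proj.toFun (((x ⇨ X.sec.toFun b) ⇨ X.sec.toFun b) ⇨ x) = ⊤ := by
  simp only [X.proj.map_himp, proj_sec_apply, hx, HeytingSemilattice.himp_self, HeytingSemilattice.top_himp]

theorem local_himp_himp_himp (h : KernelsOrthogonal f g) (x : X.obj.carrier) {b : B.carrier}
    (hx : X.proj.toFun x = b) :
    Local f g (((f.hom.toFun x ⇨ A.sec.toFun b) ⇨ A.sec.toFun b) ⇨ f.hom.toFun x) := by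
  have := local_of_proj_eq_top h (proj_himp_himp_himp x hx)
  simpa only [f.hom.map_himp, hom_sec_apply] using this

theorem local_glue (h : KernelsOrthogonal f g) {x : X.obj.carrier} {y : Y.obj.carrier}
    {b : B.carrier} (hx : X.proj.toFun x = b) (hy : Y.proj.toFun y = b) :
    Local f g (HeytingSemilattice.glue (f.hom.toFun x) (g.hom.toFun y) (A.sec.toFun b)) :=
  (local_sec h b).glue (local_himp_himp_himp h x hx) (local_himp_himp_himp h.symm y hy).symm

end Local

/-! ### Values of the cooperator -/

/-- `a` is the value of the cooperator at `(x, y)`: it agrees with `y` where `x` agrees with the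
section, and with `x` where `y` does. -/
structure IsValue (f : X ⟶ A) (g : Y ⟶ A) (x : X.obj.carrier) (y : Y.obj.carrier)
    (a : A.obj.carrier) : Prop where
  proj_eq : A.proj.toFun a = X.proj.toFun x
  isLocal : Local f g a
  exists_left : ∃ k, X.proj.toFun k = ⊤ ∧
    ModEq (f.hom.toFun k) (f.hom.toFun x) (A.sec.toFun (X.proj.toFun x)) ∧
    ModEq (f.hom.toFun k) a (g.hom.toFun y)
  exists_right : ∃ l, Y.proj.toFun l = ⊤ ∧
    ModEq (g.hom.toFun l) (g.hom.toFun y) (A.sec.toFun (Y.proj.toFun y)) ∧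
    ModEq (g.hom.toFun l) a (f.hom.toFun x)

namespace IsValue

variable {f : X ⟶ A} {g : Y ⟶ A} {x x' : X.obj.carrier} {y y' : Y.obj.carrier}
  {a a' : A.obj.carrier}

theorem proj_inf_eq_top {P : Pt B} {k k' : P.obj.carrier} (hk : P.proj.toFun k = ⊤)
    (hk' : P.proj.toFun k' = ⊤) : P.proj.toFun (k ⊓ k') = ⊤ := by
  rw [P.proj.map_inf, hk, hk', top_inf]

theorem map_inf_le_left {P Q : HSLat.{u}} (f : P ⟶ Q) (k k' : P.carrier) :
    f.toFun (k ⊓ k') ≤ f.toFun k := by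
  rw [f.map_inf]
  exact inf_le_left

theorem map_inf_le_right {P Q : HSLat.{u}} (f : P ⟶ Q) (k k' : P.carrier) :
    f.toFun (k ⊓ k') ≤ f.toFun k' := by
  rw [f.map_inf]
  exact inf_le_right

theorem unique (h : IsValue f g x y a) (h' : IsValue f g x y a') : a = a' := by
  obtain ⟨k, hk, -, hka⟩ := h.exists_left
  obtain ⟨l, hl, -, hla⟩ := h.exists_right
  obtain ⟨k', hk', -, hka'⟩ := h'.exists_left
  obtain ⟨l', hl', -, hla'⟩ := h'.exists_right
  -- The two values may come with different witnesses; the meets serve both.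
  have hs : ModEq (f.hom.toFun (k ⊓ k')) a a' :=
    (hka.mono (map_inf_le_left _ _ _)).trans (hka'.mono (map_inf_le_right _ _ _)).symm
  have ht : ModEq (g.hom.toFun (l ⊓ l')) a a' :=
    (hla.mono (map_inf_le_left _ _ _)).trans (hla'.mono (map_inf_le_right _ _ _)).symm
  exact le_antisymm
    (h'.isLocal.le_of_modEq (proj_inf_eq_top hk hk') (proj_inf_eq_top hl hl') hs ht)
    (h.isLocal.le_of_modEq (proj_inf_eq_top hk hk') (proj_inf_eq_top hl hl') hs.symm ht.symm)

theorem inf (h : IsValue f g x y a) (h' : IsValue f g x' y' a') :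
    IsValue f g (x ⊓ x') (y ⊓ y') (a ⊓ a') := by
  obtain ⟨k, hk, hkx, hka⟩ := h.exists_left
  obtain ⟨l, hl, hly, hla⟩ := h.exists_right
  obtain ⟨k', hk', hkx', hka'⟩ := h'.exists_left
  obtain ⟨l', hl', hly', hla'⟩ := h'.exists_right
  refine ⟨?_, h.isLocal.inf h'.isLocal, ⟨k ⊓ k', proj_inf_eq_top hk hk', ?_, ?_⟩,
    ⟨l ⊓ l', proj_inf_eq_top hl hl', ?_, ?_⟩⟩
  · rw [A.proj.map_inf, X.proj.map_inf, h.proj_eq, h'.proj_eq]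
  · rw [f.hom.map_inf x, X.proj.map_inf, A.sec.map_inf]
    exact (hkx.mono (map_inf_le_left _ _ _)).inf (hkx'.mono (map_inf_le_right _ _ _))
  · rw [g.hom.map_inf y]
    exact (hka.mono (map_inf_le_left _ _ _)).inf (hka'.mono (map_inf_le_right _ _ _))
  · rw [g.hom.map_inf y, Y.proj.map_inf, A.sec.map_inf]
    exact (hly.mono (map_inf_le_left _ _ _)).inf (hly'.mono (map_inf_le_right _ _ _))
  · rw [f.hom.map_inf x]
    exact (hla.mono (map_inf_le_left _ _ _)).inf (hla'.mono (map_inf_le_right _ _ _))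

theorem himp (h : IsValue f g x y a) (h' : IsValue f g x' y' a') :
    IsValue f g (x ⇨ x') (y ⇨ y') (a ⇨ a') := by
  obtain ⟨k, hk, hkx, hka⟩ := h.exists_left
  obtain ⟨l, hl, hly, hla⟩ := h.exists_right
  obtain ⟨k', hk', hkx', hka'⟩ := h'.exists_left
  obtain ⟨l', hl', hly', hla'⟩ := h'.exists_right
  refine ⟨?_, h'.isLocal.himp a, ⟨k ⊓ k', proj_inf_eq_top hk hk', ?_, ?_⟩,
    ⟨l ⊓ l', proj_inf_eq_top hl hl', ?_, ?_⟩⟩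
  · rw [A.proj.map_himp, X.proj.map_himp, h.proj_eq, h'.proj_eq]
  · rw [f.hom.map_himp x, X.proj.map_himp, A.sec.map_himp]
    exact (hkx.mono (map_inf_le_left _ _ _)).himp (hkx'.mono (map_inf_le_right _ _ _))
  · rw [g.hom.map_himp y]
    exact (hka.mono (map_inf_le_left _ _ _)).himp (hka'.mono (map_inf_le_right _ _ _))
  · rw [g.hom.map_himp y, Y.proj.map_himp, A.sec.map_himp]
    exact (hly.mono (map_inf_le_left _ _ _)).himp (hly'.mono (map_inf_le_right _ _ _))
  · rw [f.hom.map_himp x]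
    exact (hla.mono (map_inf_le_left _ _ _)).himp (hla'.mono (map_inf_le_right _ _ _))

theorem biimplication_proj {P : Pt B} (x : P.obj.carrier) :
    P.proj.toFun ((x ⇨ P.sec.toFun (P.proj.toFun x)) ⊓ (P.sec.toFun (P.proj.toFun x) ⇨ x)) = ⊤ := by
  rw [P.proj.map_inf, P.proj.map_himp, P.proj.map_himp, proj_sec_apply, HeytingSemilattice.himp_self, inf_self]

theorem biimplication_modEq {P : Pt B} (f : P ⟶ A) (x : P.obj.carrier) :
    ModEq (f.hom.toFun
        ((x ⇨ P.sec.toFun (P.proj.toFun x)) ⊓ (P.sec.toFun (P.proj.toFun x) ⇨ x)))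
      (f.hom.toFun x) (A.sec.toFun (P.proj.toFun x)) := by
  rw [f.hom.map_inf, f.hom.map_himp, f.hom.map_himp, hom_sec_apply]
  exact modEq_biimplication _ _

theorem of_glue (h : KernelsOrthogonal f g) (hxy : X.proj.toFun x = Y.proj.toFun y) :
    IsValue f g x y (glue (f.hom.toFun x) (g.hom.toFun y) (A.sec.toFun (X.proj.toFun x))) where
  proj_eq := by
    rw [A.proj.map_glue, proj_hom_apply, proj_hom_apply, proj_sec_apply, ← hxy, glue_base_left]
  isLocal := local_glue h rfl hxy.symm
  exists_left := ⟨_, biimplication_proj x, biimplication_modEq f x, by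
    have := (biimplication_modEq f x).glue (.refl _ (g.hom.toFun y))
      (A.sec.toFun (X.proj.toFun x))
    rwa [glue_base_left] at this⟩
  exists_right := ⟨_, biimplication_proj y, biimplication_modEq g y, by
    have := (ModEq.refl _ (f.hom.toFun x)).glue (biimplication_modEq g y)
      (A.sec.toFun (Y.proj.toFun y))
    rwa [glue_base_right, ← congrArg A.sec.toFun hxy] at this⟩

theorem of_left (h : KernelsOrthogonal f g) (x : X.obj.carrier) :
    IsValue f g x (Y.sec.toFun (X.proj.toFun x)) (f.hom.toFun x) := by
  have := of_glue h (Y.proj_sec_apply (X.proj.toFun x)).symm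
  rwa [hom_sec_apply, glue_base_right] at this

theorem of_right (h : KernelsOrthogonal f g) (y : Y.obj.carrier) :
    IsValue f g (X.sec.toFun (Y.proj.toFun y)) y (g.hom.toFun y) := by
  have := of_glue h (X.proj_sec_apply (Y.proj.toFun y))
  rwa [hom_sec_apply, proj_sec_apply, glue_base_left] at this

end IsValue

theorem huqCommute_of_kernelsOrthogonal {f : X ⟶ A} {g : Y ⟶ A} (h : KernelsOrthogonal f g) :
    HuqCommute f g := by
  let p₁ : X ⨯ Y ⟶ X := prod.fst
  let p₂ : X ⨯ Y ⟶ Y := prod.snd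
  let φ : (X ⨯ Y).obj.carrier → A.obj.carrier := fun z =>
    glue (f.hom.toFun (p₁.hom.toFun z)) (g.hom.toFun (p₂.hom.toFun z))
      (A.sec.toFun (X.proj.toFun (p₁.hom.toFun z)))
  have hφ : ∀ z, IsValue f g (p₁.hom.toFun z) (p₂.hom.toFun z) (φ z) := fun z =>
    .of_glue h ((proj_hom_apply p₁ z).trans (proj_hom_apply p₂ z).symm)
  have sec_eq : ∀ b, φ ((X ⨯ Y).sec.toFun b) = A.sec.toFun b := fun b => by
    simp only [φ, hom_sec_apply, proj_sec_apply, glue_base_left]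
  let Φ : (X ⨯ Y).obj ⟶ A.obj := ⟨φ,
    -- The top element lies on the section, where both arguments of `glue` equal its base.
    by rw [← (X ⨯ Y).sec.map_top, sec_eq, A.sec.map_top],
    fun z w => (hφ _).unique (by
      rw [p₁.hom.map_inf, p₂.hom.map_inf]
      exact (hφ z).inf (hφ w)),
    fun z w => (hφ _).unique (by
      rw [p₁.hom.map_himp, p₂.hom.map_himp]
      exact (hφ z).himp (hφ w))⟩
  refine ⟨⟨Φ, HSLat.hom_ext fun z => (hφ z).proj_eq.trans (proj_hom_apply p₁ z),
    HSLat.hom_ext sec_eq⟩, ?_, ?_⟩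
  -- On the axis `(x, 0)` both `φ` and `f x` are values at the same pair.
  · refine Pt.hom_ext (HSLat.hom_ext fun x => (hφ _).unique ?_)
    have h₁ : p₁.hom.toFun ((prod.lift (𝟙 X) (0 : X ⟶ Y)).hom.toFun x) = x :=
      apply_eq_of_hom_eq (prod.lift_fst (𝟙 X) (0 : X ⟶ Y)) x
    have h₂ : p₂.hom.toFun ((prod.lift (𝟙 X) (0 : X ⟶ Y)).hom.toFun x) =
        Y.sec.toFun (X.proj.toFun x) := apply_eq_of_hom_eq (prod.lift_snd (𝟙 X) (0 : X ⟶ Y)) x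
    rw [h₁, h₂]
    exact .of_left h x
  · refine Pt.hom_ext (HSLat.hom_ext fun y => (hφ _).unique ?_)
    have h₁ : p₁.hom.toFun ((prod.lift (0 : Y ⟶ X) (𝟙 Y)).hom.toFun y) =
        X.sec.toFun (Y.proj.toFun y) := apply_eq_of_hom_eq (prod.lift_fst (0 : Y ⟶ X) (𝟙 Y)) y
    have h₂ : p₂.hom.toFun ((prod.lift (0 : Y ⟶ X) (𝟙 Y)).hom.toFun y) = y :=
      apply_eq_of_hom_eq (prod.lift_snd (0 : Y ⟶ X) (𝟙 Y)) y
    rw [h₁, h₂]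
    exact .of_right h y

end Pt

theorem mainTheorem1 : SatisfiesSSH HSLat.{u} :=
  ⟨fun _ _ _ _ _ _ h => Pt.huqCommute_of_kernelsOrthogonal (Pt.kernelsOrthogonal_of_ker h),
    fun _ _ p _ _ _ _ _ h =>
      Pt.huqCommute_of_kernelsOrthogonal (Pt.kernelsOrthogonal_of_changeOfBase p h)⟩
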